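/- Let $N\in\mathbb N$ and let $K\subseteq\mathbb R^N$ be a convex Borel set (for instance $K=\mathbb R^N$). Let $H:\mathbb R^N\times\mathbb R^N\to\mathbb R$ be Borel measurable, bounded from below on $K\times\mathbb R^N$, such that $x\mapsto H(x,u)$ is concave on $K$ for every $u\in\mathbb R^N$ and $u\mapsto H(x,u)$ is convex on $\mathbb R^N$ for every $x\in K$. For a Borel probability measure $\eta$ on $\mathbb R^N$ with $\eta(K)=1$ define the value of the stochastic program $$v(\eta)=\inf_{u}\int H\bigl(x,u(x)\bigr)\,\eta(dx)\in(-\infty,+\infty],$$ where the infimum runs over Borel adapted controls $u(x)=(u_1(x_1),u_2(x_1,x_2),\dots,u_N(x_1,\dots,x_N))$. Let $\mu,\nu$ be Borel probability measures on $\mathbb R^N$ with $\mu(K)=\nu(K)=1$. Write $\eta^{x_1,\dots,x_{n-1}}$ for the regular conditional law under $\eta$ of the $n$-th coordinate given the first $n-1$ (the law of the first coordinate if $n=1$), $F_\theta$ for the distribution function of a probability measure $\theta$ on $\mathbb R$, and $F_\theta^{-1}(p)=\inf\{y: F_\theta(y)\ge p\}$. Let $U_1,\dots,U_N$ be independent and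 uniform on $[0,1]$, and define inductively $$X_n=F^{-1}_{\mu^{X_1,\dots,X_{n-1}}}(U_n),\qquad Y_n=F^{-1}_{\nu^{Y_1,\dots,Y_{n-1}}}(U_n),\qquad n=1,\dots,N .$$ The law of $(X,Y)$ is the Knothe–Rosenblatt rearrangement of $\mu$ and $\nu$, and the lexicographic displacement interpolation $[\mu,\nu]_t$, $t\in[0,1]$, is the law of $(1-t)X+tY$. The Knothe–Rosenblatt map $T=(T^1,\dots,T^N)$ is defined inductively by $$T^n(x)=F^{-1}_{\nu^{T^1(x),\dots,T^{n-1}(x)}}\bigl(F_{\mu^{x_1,\dots,x_{n-1}}}(x_n)\bigr).$$ Assume that, $\mu$-almost surely, all conditional laws $\mu^{x_1,\dots,x_{n-1}}$, $n=1,\dots,N$, are atomless. Then: 1. The function $t\in[0,1]\mapsto v([\mu,\nu]_t)\in(-\infty,+\infty]$ is concave: for all $s,t\in[0,1]$ and $a,b\ge 0$ with $a+b=1$, $$v([\mu,\nu]_{as+bt})\ \ge\ a\,v([\mu,\nu]_s)+b\,v([\mu,\nu]_t)$$ (with $0\cdot\infty=0$). 2. If $v(\mu)$ is finite and attained, then $$v(\nu)\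 \le\ v(\mu)+\inf_{u^*}\int\ \inf_{\xi\in\partial_xH(x,u^*(x))}\xi\cdot[T(x)-x]\ \mu(dx),$$ where $u^*$ runs over all optimal controls for $v(\mu)$ and $\partial_xH(x,u)=\{\xi\in\mathbb R^N: H(z,u)\le H(x,u)+\xi\cdot(z-x)\ \text{for all } z\in K\}$ is the partial superdifferential in the first variable (with $\inf\emptyset=+\infty$, the integral being understood as the integral of the positive part minus the integral of the negative part, with values in $[-\infty,+\infty]$). -/

import Mathlib

open MeasureTheory ProbabilityTheory Set

noncomputable section

/-- The extended integral `∫ f⁺ dμ - ∫ f⁻ dμ` of a function with values in `[-∞, ∞]`. -/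
def extIntegral {Ω : Type*} [MeasurableSpace Ω] (μ : Measure Ω) (f : Ω → EReal) : EReal :=
  ((∫⁻ x, (f x).toENNReal ∂μ : ENNReal) : EReal) -
    ((∫⁻ x, (-f x).toENNReal ∂μ : ENNReal) : EReal)

/-! ### Stochastic programs -/

/-- A Borel adapted (non-anticipative) control: the `n`-th component is a Borel function of the
coordinates with index `≤ n`. -/
structure AdaptedControl (N : ℕ) where
  comp : (n : Fin N) → (Iic n → ℝ) → ℝ
  measurable_comp : ∀ n, Measurable (comp n)

/-- `u(x) = (u₁(x₁), u₂(x₁, x₂), …, u_N(x₁, …, x_N))`. -/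
def AdaptedControl.eval {N : ℕ} (u : AdaptedControl N) (x : Fin N → ℝ) : Fin N → ℝ :=
  fun n => u.comp n (fun i => x i)

/-- The expected cost `∫ H(x, u(x)) η(dx)` of the control `u` under the noise distribution `η`. -/
def expectedCost {N : ℕ} (H : (Fin N → ℝ) → (Fin N → ℝ) → ℝ) (η : Measure (Fin N → ℝ))
    (u : AdaptedControl N) : EReal :=
  extIntegral η (fun x => ((H x (u.eval x) : ℝ) : EReal))

/-- The value `v(η)` of the stochastic program. -/
def programValue {N : ℕ} (H : (Fin N → ℝ) → (Fin N → ℝ) → ℝ) (η : Measure (Fin N → ℝ)) : EReal :=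
  ⨅ u : AdaptedControl N, expectedCost H η u

/-- The set of optimal controls for `v(η)`. -/
def optimalControls {N : ℕ} (H : (Fin N → ℝ) → (Fin N → ℝ) → ℝ) (η : Measure (Fin N → ℝ)) :
    Set (AdaptedControl N) :=
  {u | expectedCost H η u = programValue H η}

/-- The superdifferential at `x` of a function `f` on the set `K`. -/
def superdifferential {N : ℕ} (K : Set (Fin N → ℝ)) (f : (Fin N → ℝ) → ℝ) (x : Fin N → ℝ) :
    Set (Fin N → ℝ) :=
  {ξ | ∀ z ∈ K, f z ≤ f x + ξ ⬝ᵥ (z - x)}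

/-! ### The Knothe–Rosenblatt rearrangement -/

/-- The left-continuous generalized inverse of the distribution function of `η`. -/
def quantile (η : Measure ℝ) (p : ℝ) : ℝ :=
  sInf {y | p ≤ cdf η y}

/-- The regular conditional distribution under `η` of the `n`-th coordinate given the coordinates
of index `< n` (for the first index: the law of the first coordinate). -/
def condLaw {N : ℕ} (η : Measure (Fin N → ℝ)) [IsProbabilityMeasure η] (n : Fin N) :
    Kernel (Iio n → ℝ) ℝ :=
  condDistrib (fun x : Fin N → ℝ => x n) (fun x (i : Iio n) => x i) η

/-- All conditional distributions of `η` are atomless, `η`-almost surely. -/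
def AtomlessCondLaws {N : ℕ} (η : Measure (Fin N → ℝ)) [IsProbabilityMeasure η] : Prop :=
  ∀ᵐ x ∂η, ∀ n : Fin N, NullSingletonClass (condLaw η n (fun i => x i))

/-- The quantile transform: `Z_n = F⁻¹_{η^{Z_1, …, Z_{n-1}}}(p_n)`, inductively in `n`. -/
def quantileTransform {N : ℕ} (η : Measure (Fin N → ℝ)) [IsProbabilityMeasure η]
    (p : Fin N → ℝ) (n : Fin N) : ℝ :=
  quantile (condLaw η n (fun i : Iio n => quantileTransform η p i)) (p n)
termination_by n.val
decreasing_by exact i.2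

/-- The Knothe–Rosenblatt rearrangement of `μ` and `ν`: the joint law of the quantile transforms of
`μ` and `ν` driven by the same independent uniform variables on `[0, 1]`. -/
def knotheRosenblatt {N : ℕ} (μ ν : Measure (Fin N → ℝ)) [IsProbabilityMeasure μ]
    [IsProbabilityMeasure ν] : Measure ((Fin N → ℝ) × (Fin N → ℝ)) :=
  (Measure.pi (fun _ : Fin N => (volume : Measure ℝ).restrict (Icc 0 1))).map
    (fun p => (quantileTransform μ p, quantileTransform ν p))

/-- The Knothe–Rosenblatt map `T`, with
`T^n(x) = F⁻¹_{ν^{T^1(x), …, T^{n-1}(x)}} (F_{μ^{x_1, …, x_{n-1}}}(x_n))`. -/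
def knotheRosenblattMap {N : ℕ} (μ ν : Measure (Fin N → ℝ)) [IsProbabilityMeasure μ]
    [IsProbabilityMeasure ν] (x : Fin N → ℝ) (n : Fin N) : ℝ :=
  quantile (condLaw ν n (fun i : Iio n => knotheRosenblattMap μ ν x i))
    (cdf (condLaw μ n (fun i => x i)) (x n))
termination_by n.val
decreasing_by exact i.2

/-- The lexicographic displacement interpolation `[μ, ν]_t`. -/
def lexInterpolation {N : ℕ} (μ ν : Measure (Fin N → ℝ)) [IsProbabilityMeasure μ]
    [IsProbabilityMeasure ν] (t : ℝ) : Measure (Fin N → ℝ) :=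
  (knotheRosenblatt μ ν).map (fun z => (1 - t) • z.1 + t • z.2)

/-! ### The maps above are Borel, so that the push-forwards are probability measures -/

theorem measurable_quantile_kernel {α : Type*} [MeasurableSpace α] (κ : Kernel α ℝ)
    [IsMarkovKernel κ] : Measurable (fun z : α × ℝ => quantile (κ z.1) z.2) := by
  have hF : ∀ y : ℝ, Measurable (fun z : α × ℝ => cdf (κ z.1) y) := fun y => by
    simp_rw [cdf_eq_real]
    exact ((κ.measurable_coe measurableSet_Iic).comp measurable_fst).ennreal_toReal
  have hle : ∀ y : ℝ, MeasurableSet {z : α × ℝ | z.2 ≤ cdf (κ z.1) y} := fun y =>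
    measurableSet_le measurable_snd (hF y)
  refine measurable_of_Iic fun y => ?_
  have key : (fun z : α × ℝ => quantile (κ z.1) z.2) ⁻¹' Iic y =
      ({z | 0 < z.2} ∩ (⋃ k : ℕ, {z | z.2 ≤ cdf (κ z.1) k}) ∩ {z | z.2 ≤ cdf (κ z.1) y}) ∪
      ({z | 0 < z.2} ∩ (⋃ k : ℕ, {z | z.2 ≤ cdf (κ z.1) k})ᶜ ∩ {_z | 0 ≤ y}) ∪
      ({z | z.2 ≤ 0} ∩ {_z | 0 ≤ y}) := by
    ext ⟨a, p⟩
    simp only [mem_preimage, mem_Iic, mem_union, mem_inter_iff, mem_ofPred_eq, mem_iUnion,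
      mem_compl_iff, not_exists, not_le]
    rcases le_or_gt p 0 with hp | hp
    · have hS : {y | p ≤ cdf (κ a) y} = univ :=
        eq_univ_of_forall fun y => hp.trans (cdf_nonneg _ y)
      have : quantile (κ a) p = 0 := by rw [quantile, hS, Real.sInf_univ]
      rw [this]
      simp [hp, not_lt.2 hp]
    · by_cases hne : ∃ k : ℕ, p ≤ cdf (κ a) k
      · have hne' : ¬ ∀ k : ℕ, cdf (κ a) k < p := by push Not; exact hne
        have hbdd : BddBelow {y | p ≤ cdf (κ a) y} := by
          obtain ⟨m, hm⟩ := ((tendsto_cdf_atBot (κ a)).eventually (gt_mem_nhds hp)).exists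
          refine ⟨m, fun w hw => ?_⟩
          by_contra hlt
          exact absurd (hw.trans ((monotone_cdf (κ a)) (not_le.1 hlt).le)) (not_le.2 hm)
        have hiff : quantile (κ a) p ≤ y ↔ p ≤ cdf (κ a) y := by
          constructor
          · intro h
            have hright : ∀ w, y < w → p ≤ cdf (κ a) w := fun w hw => by
              obtain ⟨s, hs, hsw⟩ := exists_lt_of_csInf_lt
                (show {y | p ≤ cdf (κ a) y}.Nonempty from ⟨_, hne.choose_spec⟩)
                (lt_of_le_of_lt h hw)
              exact le_trans hs (monotone_cdf (κ a) hsw.le)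
            have hc : ContinuousWithinAt (cdf (κ a)) (Ioi y) y :=
              ((cdf (κ a)).right_continuous y).mono Ioi_subset_Ici_self
            exact ge_of_tendsto hc (Filter.eventually_of_mem self_mem_nhdsWithin hright)
          · exact fun h => csInf_le hbdd h
        rw [hiff]
        simp [hp, hne, hne', not_le.2 hp]
      · have hall : ∀ k : ℕ, cdf (κ a) k < p := by push Not at hne; exact hne
        have hS : {y | p ≤ cdf (κ a) y} = ∅ := by
          refine eq_empty_of_forall_notMem fun w hw => ?_
          obtain ⟨k, hk⟩ := exists_nat_ge w
          exact absurd (le_trans hw (monotone_cdf (κ a) hk)) (not_le.2 (hall k))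
        have : quantile (κ a) p = 0 := by rw [quantile, hS, Real.sInf_empty]
        rw [this]
        simp [hp, hne, hall, not_le.2 hp]
  rw [key]
  have h0 : MeasurableSet {z : α × ℝ | 0 < z.2} := measurableSet_lt measurable_const measurable_snd
  have h1 : MeasurableSet {z : α × ℝ | z.2 ≤ 0} := measurableSet_le measurable_snd measurable_const
  have h2 : MeasurableSet (⋃ k : ℕ, {z : α × ℝ | z.2 ≤ cdf (κ z.1) k}) :=
    MeasurableSet.iUnion fun k => hle k
  exact (((h0.inter h2).inter (hle y)).union ((h0.inter h2.compl).inter (.const _))).union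
    (h1.inter (.const _))

instance {N : ℕ} (η : Measure (Fin N → ℝ)) [IsProbabilityMeasure η] (n : Fin N) :
    IsMarkovKernel (condLaw η n) := by
  unfold condLaw; infer_instance

theorem measurable_quantileTransform {N : ℕ} (η : Measure (Fin N → ℝ)) [IsProbabilityMeasure η] :
    Measurable (quantileTransform η) := by
  have h : ∀ (k : ℕ) (n : Fin N), n.val = k → Measurable (fun p => quantileTransform η p n) := by
    intro k
    induction k using Nat.strong_induction_on with
    | _ k ih =>
      intro n hn
      have hrec : (fun p => quantileTransform η p n) = fun p =>
          quantile (condLaw η n (fun i : Iio n => quantileTransform η p i)) (p n) := by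
        funext p; rw [quantileTransform]
      rw [hrec]
      refine (measurable_quantile_kernel (condLaw η n)).comp
        ((measurable_pi_lambda _ fun i => ?_).prodMk (measurable_pi_apply n))
      exact ih i.1.val (hn ▸ i.2) i.1 rfl
  exact measurable_pi_lambda _ fun n => h n.val n rfl

instance {N : ℕ} (μ ν : Measure (Fin N → ℝ)) [IsProbabilityMeasure μ] [IsProbabilityMeasure ν] :
    IsProbabilityMeasure (knotheRosenblatt μ ν) := by
  have : IsProbabilityMeasure ((volume : Measure ℝ).restrict (Icc 0 1)) := ⟨by simp⟩
  exact Measure.isProbabilityMeasure_map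
    ((measurable_quantileTransform μ).prodMk (measurable_quantileTransform ν)).aemeasurable

instance {N : ℕ} (μ ν : Measure (Fin N → ℝ)) [IsProbabilityMeasure μ] [IsProbabilityMeasure ν]
    (t : ℝ) : IsProbabilityMeasure (lexInterpolation μ ν t) :=
  Measure.isProbabilityMeasure_map (by fun_prop)

end

/-! Write `S_μ`, `S_ν` for the quantile transforms. The law `[μ, ν]_t` is the image of the uniform
cube under the triangular map `W_t = (1 - t) S_μ + t S_ν`, and `W_{as+bt} = a W_s + b W_t`. Programs
for different `t` can therefore be compared on the cube, with triangular maps `w` of the uniform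
seeds as common controls.

The crux is `v([μ, ν]_t) ≤ ∫ H(W_t, w)` for every triangular `w`
(`adaptedValue_lexInterpolation_le`, for nonnegative costs): observing the seeds is no better than
observing the path `W_t`. For `t < 1`, atomlessness of the conditional laws of `μ` makes the `n`-th
component of `W_t` strictly increasing in the `n`-th seed, so the seeds are an adapted function of
the path (`Triangular.exists_leftInverse`). At `t = 1` the law `ν` may have atoms. The seeds are
then rebuilt from the path and an independent uniform point `v`
(`map_sequentialDistributionalTransform`, `quantileTransform_sequentialDistributionalTransform`);
each fixed `v` yields an adapted control, and one averages over `v`.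

For concavity, a control `u` at `r = as + bt` induces `w = u ∘ W_r` with the same cost. Using this
`w` at `s` and `t` as well reduces the claim to pointwise concavity of `H(·, w)`. For the second
claim, take `w = u ∘ S_μ` with `u` optimal for `μ`. Since `T ∘ S_μ = S_ν` almost everywhere, `v(ν) ≤
∫ H(T(x), u(x)) μ(dx)`, and the supergradient inequality bounds the increment of `H`. Subtracting a
lower bound of `H` turns all costs into `ENNReal` integrals. -/

/-! ### Quantile functions -/

/-- The uniform distribution on `[0, 1]`. -/
noncomputable abbrev uniform01 : Measure ℝ := (volume : Measure ℝ).restrict (Icc 0 1)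

instance : IsProbabilityMeasure uniform01 := ⟨by simp⟩

theorem ae_uniform01_mem_Ioo : ∀ᵐ p ∂uniform01, p ∈ Ioo (0 : ℝ) 1 := by
  have : uniform01 = (volume : Measure ℝ).restrict (Ioo 0 1) :=
    Measure.restrict_congr_set Ioo_ae_eq_Icc.symm
  rw [this]
  exact ae_restrict_mem measurableSet_Ioo

theorem uniform01_Iic {p : ℝ} (hp : p ∈ Icc (0 : ℝ) 1) : uniform01 (Iic p) = ENNReal.ofReal p := by
  have h : Iic p ∩ Icc (0 : ℝ) 1 = Icc 0 p := by
    ext q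
    exact ⟨fun h => ⟨h.2.1, h.1⟩, fun h => ⟨h.2, h.1, h.2.trans hp.2⟩⟩
  rw [Measure.restrict_apply measurableSet_Iic, h, Real.volume_Icc, sub_zero]

/-- Right-continuity of the distribution function makes the infimum attained. Outside `(0, 1)` the
set may be empty or unbounded below, where `sInf` takes a default value. -/
theorem quantile_le_iff (η : Measure ℝ) {p : ℝ} (hp : p ∈ Ioo (0 : ℝ) 1) (y : ℝ) :
    quantile η p ≤ y ↔ p ≤ cdf η y := by
  have hne : {y | p ≤ cdf η y}.Nonempty :=
    (((tendsto_cdf_atTop η).eventually (lt_mem_nhds hp.2)).exists).imp fun _ h => h.le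
  have hbdd : BddBelow {y | p ≤ cdf η y} := by
    obtain ⟨m, hm⟩ := ((tendsto_cdf_atBot η).eventually (gt_mem_nhds hp.1)).exists
    refine ⟨m, fun w hw => ?_⟩
    by_contra hlt
    exact absurd (le_trans hw ((monotone_cdf η) (not_le.1 hlt).le)) (not_le.2 hm)
  refine ⟨fun h => ?_, fun h => csInf_le hbdd h⟩
  have hright : ∀ w, y < w → p ≤ cdf η w := fun w hw => by
    obtain ⟨s, hs, hsw⟩ := exists_lt_of_csInf_lt hne (lt_of_le_of_lt h hw)
    exact le_trans hs (monotone_cdf η hsw.le)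
  have hc : ContinuousWithinAt (cdf η) (Ioi y) y :=
    ((cdf η).right_continuous y).mono Ioi_subset_Ici_self
  exact ge_of_tendsto hc (Filter.eventually_of_mem self_mem_nhdsWithin hright)

theorem monotoneOn_quantile (η : Measure ℝ) : MonotoneOn (quantile η) (Ioo 0 1) :=
  fun _ hp _ hq hpq => (quantile_le_iff η hp _).2 (hpq.trans ((quantile_le_iff η hq _).1 le_rfl))

theorem measurable_quantile (η : Measure ℝ) [IsProbabilityMeasure η] :
    Measurable (quantile η) :=
  (measurable_quantile_kernel (Kernel.const Unit η)).comp
    (measurable_const (a := ()).prodMk measurable_id)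

theorem map_quantile_uniform01 (η : Measure ℝ) [IsProbabilityMeasure η] :
    uniform01.map (quantile η) = η := by
  have := Measure.isProbabilityMeasure_map (μ := uniform01) (measurable_quantile η).aemeasurable
  refine Measure.ext_of_Iic _ _ fun y => ?_
  rw [Measure.map_apply (measurable_quantile η) measurableSet_Iic, ← ofReal_cdf η y,
    ← uniform01_Iic ⟨cdf_nonneg η y, cdf_le_one η y⟩]
  refine measure_congr ?_
  filter_upwards [ae_uniform01_mem_Ioo] with p hp
  exact propext (quantile_le_iff η hp y)

/-- Equal quantiles at `p < q` would make the quantile function constant on `[p, q]`, giving an atom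
of mass at least `q - p`. -/
theorem strictMonoOn_quantile (η : Measure ℝ) [IsProbabilityMeasure η] [NullSingletonClass η] :
    StrictMonoOn (quantile η) (Ioo 0 1) := by
  intro p hp q hq hpq
  refine lt_of_le_of_ne (monotoneOn_quantile η hp hq hpq.le) fun heq => ?_
  have h0 : uniform01 (quantile η ⁻¹' {quantile η p}) = 0 := by
    rw [← Measure.map_apply (measurable_quantile η) (measurableSet_singleton _),
      map_quantile_uniform01]
    exact measure_singleton _
  have hsub : Icc p q ⊆ quantile η ⁻¹' {quantile η p} := fun r hr => by
    have hr' : r ∈ Ioo (0 : ℝ) 1 := ⟨hp.1.trans_le hr.1, hr.2.trans_lt hq.2⟩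
    exact le_antisymm ((monotoneOn_quantile η hr' hq hr.2).trans heq.ge)
      (monotoneOn_quantile η hp hr' hr.1)
  have h1 := measure_mono_null hsub h0
  rw [Measure.restrict_apply measurableSet_Icc,
    inter_eq_left.2 (Icc_subset_Icc hp.1.le hq.2.le), Real.volume_Icc,
    ENNReal.ofReal_eq_zero] at h1
  linarith

theorem cdf_map_uniform01_of_strictMonoOn {g : ℝ → ℝ} (hg : Measurable g)
    (hmono : StrictMonoOn g (Ioo 0 1)) {p : ℝ} (hp : p ∈ Ioo (0 : ℝ) 1) :
    cdf (uniform01.map g) (g p) = p := by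
  have := Measure.isProbabilityMeasure_map (μ := uniform01) hg.aemeasurable
  rw [cdf_eq_real, measureReal_def, Measure.map_apply hg measurableSet_Iic]
  have : uniform01 (g ⁻¹' Iic (g p)) = uniform01 (Iic p) := by
    refine measure_congr ?_
    filter_upwards [ae_uniform01_mem_Ioo] with q hq
    exact propext (hmono.le_iff_le hq hp)
  rw [this, uniform01_Iic ⟨hp.1.le, hp.2.le⟩, ENNReal.toReal_ofReal hp.1.le]

theorem cdf_quantile (η : Measure ℝ) [IsProbabilityMeasure η] [NullSingletonClass η] {p : ℝ}
    (hp : p ∈ Ioo (0 : ℝ) 1) : cdf η (quantile η p) = p := by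
  have := cdf_map_uniform01_of_strictMonoOn (measurable_quantile η) (strictMonoOn_quantile η) hp
  rwa [map_quantile_uniform01] at this

theorem measurable_cdf_kernel {α : Type*} [MeasurableSpace α] (κ : Kernel α ℝ)
    [IsMarkovKernel κ] : Measurable (fun z : α × ℝ => cdf (κ z.1) z.2) := by
  simp_rw [cdf_eq_real, measureReal_def]
  have hs : MeasurableSet {w : (α × ℝ) × ℝ | w.2 ≤ w.1.2} :=
    measurableSet_le measurable_snd (measurable_snd.comp measurable_fst)
  exact (Kernel.measurable_kernel_prodMk_left (κ := κ.comap Prod.fst measurable_fst)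
    hs).ennreal_toReal

/-! ### Kernels represented by maps -/

/-- Sampling a kernel by a map with independent noise. The map `φ` allows the sampler `g` to use
more information than the conditional law depends on. -/
theorem map_prod_eq_map_compProd {α β γ E : Type*} [MeasurableSpace α] [MeasurableSpace β]
    [MeasurableSpace γ] [MeasurableSpace E] (m : Measure α) [SFinite m] (ρ : Measure E) [SFinite ρ]
    {φ : α → β} (hφ : Measurable φ) (κ : Kernel β γ) [IsSFiniteKernel κ] {g : α × E → γ}
    (hg : Measurable g) (h : ∀ a, ρ.map (fun e => g (a, e)) = κ (φ a)) :
    (m.prod ρ).map (fun z => (φ z.1, g z)) = m.map φ ⊗ₘ κ := by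
  have hm : Measurable (fun z : α × E => (φ z.1, g z)) := (hφ.comp measurable_fst).prodMk hg
  ext s hs
  rw [Measure.map_apply hm hs, Measure.prod_apply (hm hs), Measure.compProd_apply hs,
    lintegral_map (Kernel.measurable_kernel_prodMk_left hs) hφ]
  refine lintegral_congr fun a => ?_
  rw [← h a, Measure.map_apply (by fun_prop) (measurable_prodMk_left hs)]
  rfl

theorem map_prod_quantile {α : Type*} [MeasurableSpace α] (m : Measure α) [SFinite m]
    (κ : Kernel α ℝ) [IsMarkovKernel κ] :
    (m.prod uniform01).map (fun z => (z.1, quantile (κ z.1) z.2)) = m ⊗ₘ κ :=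
  (map_prod_eq_map_compProd m _ measurable_id κ (measurable_quantile_kernel κ)
    fun a => map_quantile_uniform01 (κ a)).trans (by rw [Measure.map_id])

/-- The joint law of a quantile and the uniform variable generating it. -/
noncomputable def quantileCoupling {α : Type*} [MeasurableSpace α] (κ : Kernel α ℝ) :
    Kernel α (ℝ × ℝ) :=
  (Kernel.id ×ₖ Kernel.const α uniform01).map (fun z => (quantile (κ z.1) z.2, z.2))

section Coupling

variable {α : Type*} [MeasurableSpace α] (κ : Kernel α ℝ) [IsMarkovKernel κ]

theorem quantileCoupling_apply (a : α) :
    quantileCoupling κ a = uniform01.map (fun u => (quantile (κ a) u, u)) := by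
  have hm : Measurable (fun z : α × ℝ => (quantile (κ z.1) z.2, z.2)) :=
    (measurable_quantile_kernel κ).prodMk measurable_snd
  rw [quantileCoupling, Kernel.map_apply _ hm, Kernel.prod_apply, Kernel.id_apply,
    Kernel.const_apply, Measure.dirac_prod, Measure.map_map hm measurable_prodMk_left]
  rfl

instance : IsMarkovKernel (quantileCoupling κ) :=
  Kernel.IsMarkovKernel.map _ ((measurable_quantile_kernel κ).prodMk measurable_snd)

theorem quantileCoupling_map_fst (a : α) : (quantileCoupling κ a).map Prod.fst = κ a := by
  rw [quantileCoupling_apply, Measure.map_map measurable_fst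
    ((measurable_quantile _).prodMk measurable_id')]
  exact map_quantile_uniform01 (κ a)

theorem quantileCoupling_map_snd (a : α) : (quantileCoupling κ a).map Prod.snd = uniform01 := by
  rw [quantileCoupling_apply, Measure.map_map measurable_snd
    ((measurable_quantile _).prodMk measurable_id')]
  exact Measure.map_id

theorem ae_quantileCoupling (a : α) : ∀ᵐ z ∂quantileCoupling κ a, z.1 = quantile (κ a) z.2 := by
  have hm := measurable_quantile (κ a)
  rw [quantileCoupling_apply]
  exact (ae_map_iff (hm.prodMk measurable_id').aemeasurable
    (measurableSet_eq_fun measurable_fst (hm.comp measurable_snd))).2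
    (Filter.Eventually.of_forall fun _ => rfl)

/-- A uniform variable generating the given quantile, reconstructed with an additional uniform
variable. -/
noncomputable def distributionalTransform (z : α × ℝ) (v : ℝ) : ℝ :=
  quantile ((quantileCoupling κ).condKernel z) v

theorem measurable_distributionalTransform :
    Measurable (fun w : (α × ℝ) × ℝ => distributionalTransform κ w.1 w.2) :=
  measurable_quantile_kernel _

/-- The first entry has law `κ a`, the first marginal of the coupling; the second samples, by its
quantile function, the conditional law of the seed given the first. Disintegration puts the coupling
back together. -/
theorem map_distributionalTransform (a : α) :
    (uniform01.prod uniform01).map (fun e : ℝ × ℝ =>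
      (quantile (κ a) e.1, distributionalTransform κ (a, quantile (κ a) e.1) e.2)) =
    quantileCoupling κ a := by
  have h1 : (uniform01.prod uniform01).map (Prod.map (quantile (κ a)) id) =
      (κ a).prod uniform01 := by
    rw [← Measure.map_prod_map _ _ (measurable_quantile _) measurable_id, map_quantile_uniform01,
      Measure.map_id]
  have h2 := map_prod_quantile (κ a) ((quantileCoupling κ).condKernel.sectR a)
  rw [← h1, Measure.map_map (measurable_fst.prodMk (measurable_quantile_kernel _))
    ((measurable_quantile _).prodMap measurable_id)] at h2
  refine h2.trans ?_
  rw [← quantileCoupling_map_fst κ a, ← Kernel.map_apply _ measurable_fst, ← Kernel.fst_eq,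
    ← Kernel.compProd_apply_eq_compProd_sectR, Kernel.disintegrate]

end Coupling

/-! ### Triangular maps -/

/-- A measurable map of finite sequences whose `n`-th component depends on the entries with index
`≤ n` only. -/
structure Triangular {N : ℕ} {E F : Type*} [MeasurableSpace E] [MeasurableSpace F]
    (w : (Fin N → E) → Fin N → F) : Prop where
  measurable : Measurable w
  congr : ∀ n x y, (∀ i ≤ n, x i = y i) → w x n = w y n

namespace Triangular

variable {N : ℕ} {E F G : Type*} [MeasurableSpace E] [MeasurableSpace F] [MeasurableSpace G]

theorem comp {v : (Fin N → F) → Fin N → G} {w : (Fin N → E) → Fin N → F} (hv : Triangular v)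
    (hw : Triangular w) : Triangular (fun x => v (w x)) where
  measurable := hv.measurable.comp hw.measurable
  congr n x y h := hv.congr n _ _ fun i hi => hw.congr i x y fun j hj => h j (hj.trans hi)

theorem initial_congr {w : (Fin N → E) → Fin N → F} (hw : Triangular w) {n : Fin N}
    {x y : Fin N → E} (h : ∀ i < n, x i = y i) :
    (fun i : Iio n => w x i) = fun i : Iio n => w y i :=
  funext fun i => hw.congr i x y fun j hj => h j (hj.trans_lt i.2)

theorem measurable_initial {w : (Fin N → E) → Fin N → F} (hw : Triangular w) (n : Fin N) :
    Measurable (fun x => fun i : Iio n => w x i) := by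
  have := hw.measurable
  fun_prop

end Triangular

theorem AdaptedControl.triangular {N : ℕ} (u : AdaptedControl N) : Triangular u.eval where
  measurable := measurable_pi_lambda _ fun n => (u.measurable_comp n).comp (by fun_prop)
  congr n x y h := congrArg (u.comp n) (funext fun i => h i i.2)

theorem Triangular.exists_adaptedControl {N : ℕ} {w : (Fin N → ℝ) → Fin N → ℝ}
    (hw : Triangular w) : ∃ u : AdaptedControl N, u.eval = w := by
  classical
  refine ⟨⟨fun n p => w (fun i => if h : i ≤ n then p ⟨i, h⟩ else 0) n, fun n => ?_⟩, ?_⟩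
  · refine (measurable_pi_apply n).comp (hw.measurable.comp (measurable_pi_lambda _ fun i => ?_))
    by_cases h : i ≤ n
    · simp only [h, dite_true]; exact measurable_pi_apply _
    · simp only [h, dite_false]; exact measurable_const
  · funext x n
    exact hw.congr n _ _ fun i hi => by simp [hi]

theorem triangular_quantileTransform {N : ℕ} (η : Measure (Fin N → ℝ)) [IsProbabilityMeasure η] :
    Triangular (quantileTransform η) where
  measurable := measurable_quantileTransform η
  congr n x y h := by
    induction n using WellFoundedLT.induction with
    | ind n ih =>
      rw [quantileTransform, quantileTransform, h n le_rfl]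
      congr 2
      funext i
      exact ih i i.2 fun j hj => h j (hj.trans i.2.le)

/-! ### Finite sequences determined by successive conditional laws -/

theorem ext_of_successive_conditional {N : ℕ} {E : Type*} [MeasurableSpace E] [Nonempty E]
    {P Q : Measure (Fin N → E)} [IsProbabilityMeasure P] [IsProbabilityMeasure Q]
    (κ : ∀ n : Fin N, Kernel (Iio n → E) E)
    (hP : ∀ n, P.map (fun x => (fun i : Iio n => x i, x n)) =
      P.map (fun x (i : Iio n) => x i) ⊗ₘ κ n)
    (hQ : ∀ n, Q.map (fun x => (fun i : Iio n => x i, x n)) =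
      Q.map (fun x (i : Iio n) => x i) ⊗ₘ κ n) : P = Q := by
  classical
  obtain ⟨e⟩ := ‹Nonempty E›
  -- Truncation: coordinates from `k` on are overwritten by the fixed point `e`, so the induction on
  -- `k` stays in one space.
  let T : ℕ → (Fin N → E) → Fin N → E := fun k x i => if i.val < k then x i else e
  have hT : ∀ k, Measurable (T k) := fun k => measurable_pi_lambda _ fun i => by
    by_cases h : i.val < k
    · simp only [T, h, if_true]; exact measurable_pi_apply _
    · simp only [T, h, if_false]; exact measurable_const
  have key : ∀ k, P.map (T k) = Q.map (T k) := by
    intro k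
    induction k with
    | zero =>
      have : T 0 = fun _ _ => e := by funext x i; simp [T]
      rw [this, Measure.map_const, Measure.map_const, measure_univ, measure_univ]
    | succ k ih =>
      by_cases hk : k < N
      · let n : Fin N := ⟨k, hk⟩
        let R : (Fin N → E) → Iio n → E := fun x i => x i
        have hR : Measurable R := by fun_prop
        have hRT : ∀ x, R (T k x) = R x := fun x => funext fun i => if_pos i.2
        have h1 : ∀ M : Measure (Fin N → E), M.map R = (M.map (T k)).map R := fun M => by
          rw [Measure.map_map hR (hT k)]
          exact congrArg (M.map ·) (funext fun x => (hRT x).symm)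
        let S : (Iio n → E) × E → Fin N → E := fun z i =>
          if h : i < n then z.1 ⟨i, h⟩ else if i = n then z.2 else e
        have hS : Measurable S := measurable_pi_lambda _ fun i => by
          by_cases h : i < n
          · simp only [S, h, dite_true]; fun_prop
          · by_cases h' : i = n
            · have : (fun z => S z i) = Prod.snd := by funext z; simp [S, h']
              rw [this]; exact measurable_snd
            · simp only [S, h, h', dite_false, if_false]; fun_prop
        have hST : T (k + 1) = fun x => S (R x, x n) := by
          funext x i
          rcases lt_trichotomy i n with h | h | h
          · have h' : i.val < k + 1 := Nat.lt_succ_of_lt h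
            simp [T, S, R, h, h']
          · have h' : i.val < k + 1 := by rw [h]; exact Nat.lt_succ_self k
            simp [T, S, h, n]
          · have h' : ¬ i.val < k + 1 := not_lt.2 (Nat.succ_le_of_lt h)
            simp [T, S, h.not_gt, h.ne', h']
        have h2 : ∀ M : Measure (Fin N → E), M.map (T (k + 1)) =
            (M.map (fun x => (R x, x n))).map S := fun M => by
          rw [Measure.map_map hS (hR.prodMk (measurable_pi_apply n)), hST]; rfl
        rw [h2, h2, hP n, hQ n]
        change (P.map R ⊗ₘ κ n).map S = (Q.map R ⊗ₘ κ n).map S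
        rw [h1 P, h1 Q, ih]
      · have : T (k + 1) = T k := by
          funext x i
          have h1 : i.val < k := i.2.trans_le (not_lt.1 hk)
          simp [T, h1, h1.trans (Nat.lt_succ_self k)]
        rw [this, ih]
  have hid : T N = id := by funext x i; simp [T]
  simpa [hid] using key N

/-- A function of the coordinates before `n` is independent of the `n`-th one; `φ` below factors `f`
through those coordinates. -/
theorem pi_map_initial_prodMk {N : ℕ} {E β : Type*} [MeasurableSpace E] [MeasurableSpace β]
    (ρ : Measure E) [IsProbabilityMeasure ρ] (n : Fin N) {f : (Fin N → E) → β}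
    (hf : Measurable f) (hdep : ∀ x y, (∀ i < n, x i = y i) → f x = f y) :
    (Measure.pi fun _ : Fin N => ρ).map (fun x => (f x, x n)) =
      ((Measure.pi fun _ : Fin N => ρ).map f).prod ρ := by
  classical
  obtain ⟨e⟩ := ρ.nonempty_of_neZero
  let S : Finset (Fin N) := Finset.univ.filter (· < n)
  have hind : iIndepFun (fun (i : Fin N) (x : Fin N → E) => x i) (Measure.pi fun _ => ρ) :=
    iIndepFun_pi (μ := fun _ : Fin N => ρ) (X := fun _ x => x) fun _ => aemeasurable_id
  have h := hind.indepFun_finset S {n} (by simp [S]) fun i => measurable_pi_apply i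
  let φ : (S → E) → β := fun a => f fun i => if hi : i ∈ S then a ⟨i, hi⟩ else e
  have hφ : Measurable φ := hf.comp (measurable_pi_lambda _ fun i => by
    by_cases hi : i ∈ S
    · simp only [hi, dite_true]; fun_prop
    · simp only [hi, dite_false]; fun_prop)
  have h2 := h.comp hφ (measurable_pi_apply (⟨n, Finset.mem_singleton_self n⟩ : ({n} : Finset _)))
  have hfφ : (φ ∘ fun (x : Fin N → E) (i : S) => x i) = f := by
    funext x
    refine hdep _ _ fun i hi => ?_
    have : i ∈ S := by simpa [S] using hi
    simp [this]
  rw [hfφ, indepFun_iff_map_prod_eq_prod_map_map hf.aemeasurable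
    ((measurable_pi_apply _).comp (by fun_prop)).aemeasurable] at h2
  refine h2.trans ?_
  congr 1
  exact (measurePreserving_eval (fun _ : Fin N => ρ) n).map_eq

theorem pi_map_initial_compProd {N : ℕ} {E α β γ : Type*} [MeasurableSpace E] [MeasurableSpace α]
    [MeasurableSpace β] [MeasurableSpace γ]
    (ρ : Measure E) [IsProbabilityMeasure ρ] (n : Fin N) {f : (Fin N → E) → α}
    (hf : Measurable f) (hdep : ∀ x y, (∀ i < n, x i = y i) → f x = f y) {φ : α → β}
    (hφ : Measurable φ) (κ : Kernel β γ) [IsMarkovKernel κ] {g : α × E → γ} (hg : Measurable g)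
    (h : ∀ a, ρ.map (fun e => g (a, e)) = κ (φ a)) :
    (Measure.pi fun _ : Fin N => ρ).map (fun x => (φ (f x), g (f x, x n))) =
      (Measure.pi fun _ : Fin N => ρ).map (fun x => φ (f x)) ⊗ₘ κ := by
  have h1 := map_prod_eq_map_compProd ((Measure.pi fun _ : Fin N => ρ).map f) ρ hφ κ hg h
  rw [← pi_map_initial_prodMk ρ n hf hdep, Measure.map_map (by fun_prop) (by fun_prop),
    Measure.map_map hφ hf] at h1
  exact h1

/-- The uniform distribution on the unit cube. -/
noncomputable abbrev uniformCube (N : ℕ) : Measure (Fin N → ℝ) :=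
  Measure.pi fun _ : Fin N => uniform01

theorem map_quantileTransform {N : ℕ} (η : Measure (Fin N → ℝ)) [IsProbabilityMeasure η] :
    (uniformCube N).map (quantileTransform η) = η := by
  have hS := triangular_quantileTransform η
  have := Measure.isProbabilityMeasure_map (μ := uniformCube N) hS.measurable.aemeasurable
  refine ext_of_successive_conditional (condLaw η) (fun n => ?_) fun n => ?_
  · rw [Measure.map_map (by fun_prop) hS.measurable, Measure.map_map (by fun_prop) hS.measurable]
    have h := pi_map_initial_compProd uniform01 n
      (f := fun x (i : Iio n) => quantileTransform η x i) (hS.measurable_initial n)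
      (fun x y h => hS.initial_congr h) (φ := id) measurable_id (condLaw η n)
      (g := fun z => quantile (condLaw η n z.1) z.2) (measurable_quantile_kernel (condLaw η n)) fun a => map_quantile_uniform01 (condLaw η n a)
    refine Eq.trans ?_ h
    congr 1
    funext x
    refine Prod.ext rfl ?_
    change quantileTransform η x n = _
    rw [quantileTransform]
  · exact (compProd_map_condDistrib (measurable_pi_apply n).aemeasurable).symm

/-! ### Reconstruction of the uniform variables from the quantile transform -/

/-- A uniform point of the cube generating the sequence `y` through the quantile transform,
reconstructed from `y` and an independent uniform point `v`. -/
noncomputable def sequentialDistributionalTransform {N : ℕ} (η : Measure (Fin N → ℝ))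
    [IsProbabilityMeasure η] (z : (Fin N → ℝ) × (Fin N → ℝ)) (n : Fin N) : ℝ :=
  distributionalTransform (condLaw η n) (fun i : Iio n => z.1 i, z.1 n) (z.2 n)

section

variable {N : ℕ} (η : Measure (Fin N → ℝ)) [IsProbabilityMeasure η]

theorem measurable_sequentialDistributionalTransform :
    Measurable (sequentialDistributionalTransform η) :=
  measurable_pi_lambda _ fun n =>
    (measurable_distributionalTransform (condLaw η n)).comp (g := fun w => _)
      (f := fun z : (Fin N → ℝ) × (Fin N → ℝ) => ((fun i : Iio n => z.1 i, z.1 n), z.2 n))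
      (by fun_prop)

theorem triangular_sequentialDistributionalTransform (v : Fin N → ℝ) :
    Triangular (fun y => sequentialDistributionalTransform η (y, v)) where
  measurable := (measurable_sequentialDistributionalTransform η).comp measurable_prodMk_right
  congr n x y h := by
    have h1 : (fun i : Iio n => x i) = fun i : Iio n => y i := funext fun i => h i i.2.le
    simp only [sequentialDistributionalTransform, h1, h n le_rfl]

/-- The pairs (quantile transform, additional uniform point) built from independent pairs of
uniform variables. -/
noncomputable def quantileTransformPair (ω : Fin N → ℝ × ℝ) : (Fin N → ℝ) × (Fin N → ℝ) :=
  (quantileTransform η (fun n => (ω n).1), fun n => (ω n).2)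

theorem measurable_quantileTransformPair : Measurable (quantileTransformPair η) :=
  ((measurable_quantileTransform η).comp (by fun_prop)).prodMk (by fun_prop)

theorem map_quantileTransformPair :
    (Measure.pi fun _ : Fin N => uniform01.prod uniform01).map (quantileTransformPair η) =
      η.prod (uniformCube N) := by
  have h := (measurePreserving_arrowProdEquivProdArrow ℝ ℝ (Fin N) (fun _ => uniform01)
    (fun _ => uniform01))
  have h1 := h.map_eq
  have h2 : (uniformCube N).prod (uniformCube N) =
    (Measure.pi fun _ : Fin N => uniform01.prod uniform01).map
      (MeasurableEquiv.arrowProdEquivProdArrow ℝ ℝ (Fin N)) := h1.symm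
  have h3 : (quantileTransformPair η) = Prod.map (quantileTransform η) id ∘
      (MeasurableEquiv.arrowProdEquivProdArrow ℝ ℝ (Fin N)) := rfl
  rw [h3, ← Measure.map_map ((measurable_quantileTransform η).prodMap measurable_id) h.measurable,
    ← h2, ← Measure.map_prod_map _ _ (measurable_quantileTransform η) measurable_id,
    map_quantileTransform, Measure.map_id]

theorem sequentialDistributionalTransform_pair_apply (ω : Fin N → ℝ × ℝ) (n : Fin N) :
    sequentialDistributionalTransform η (quantileTransformPair η ω) n =
      distributionalTransform (condLaw η n)
        (fun i : Iio n => (quantileTransformPair η ω).1 i,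
          quantile (condLaw η n (fun i : Iio n => (quantileTransformPair η ω).1 i)) (ω n).1)
        (ω n).2 := by
  have : (quantileTransformPair η ω).1 n =
      quantile (condLaw η n (fun i : Iio n => (quantileTransformPair η ω).1 i)) (ω n).1 := by
    change quantileTransform η (fun n => (ω n).1) n = _
    rw [quantileTransform]
    rfl
  rw [← this]
  rfl

theorem triangular_quantileTransformPair_fst :
    Triangular (fun ω => (quantileTransformPair η ω).1) where
  measurable := measurable_fst.comp (measurable_quantileTransformPair η)
  congr n x y h := (triangular_quantileTransform η).congr n _ _ fun i hi => by rw [h i hi]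

theorem triangular_sequentialDistributionalTransform_pair :
    Triangular (fun ω => sequentialDistributionalTransform η (quantileTransformPair η ω)) where
  measurable := (measurable_sequentialDistributionalTransform η).comp
    (measurable_quantileTransformPair η)
  congr n x y h := by
    have h1 := (triangular_quantileTransformPair_fst η).initial_congr (n := n)
      (fun i hi => h i hi.le)
    simp only [sequentialDistributionalTransform_pair_apply, h1, h n le_rfl]

theorem map_sequentialDistributionalTransform :
    (η.prod (uniformCube N)).map (sequentialDistributionalTransform η) = uniformCube N := by
  rw [← map_quantileTransformPair η, Measure.map_map
    (measurable_sequentialDistributionalTransform η) (measurable_quantileTransformPair η)]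
  have hT := triangular_sequentialDistributionalTransform_pair η
  have hY := triangular_quantileTransformPair_fst η
  have hT' : Measurable
    (sequentialDistributionalTransform η ∘ quantileTransformPair η) := hT.measurable
  have := Measure.isProbabilityMeasure_map
    (μ := Measure.pi fun _ : Fin N => uniform01.prod uniform01) hT'.aemeasurable
  refine ext_of_successive_conditional (fun n => Kernel.const _ uniform01) (fun n => ?_) fun n => ?_
  · rw [Measure.map_map (by fun_prop) hT', Measure.map_map (by fun_prop) hT']
    -- The past must carry the path as well as the rebuilt seeds, since the next seed is built from
    -- the path. For every such past the new seed is uniform, so forgetting the path (`φ` is the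
    -- first projection) leaves a constant kernel.
    have h := pi_map_initial_compProd (uniform01.prod uniform01) n
      (f := fun ω => (fun i : Iio n => sequentialDistributionalTransform η
          (quantileTransformPair η ω) i, fun i : Iio n => (quantileTransformPair η ω).1 i))
      ((hT.measurable_initial n).prodMk (hY.measurable_initial n))
      (fun x y h => Prod.ext (hT.initial_congr h) (hY.initial_congr h)) measurable_fst
      (Kernel.const _ uniform01)
      (g := fun w => distributionalTransform (condLaw η n)
        (w.1.2, quantile (condLaw η n w.1.2) w.2.1) w.2.2)
      ?_ ?_
    · refine Eq.trans ?_ h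
      congr 1
      funext ω
      exact Prod.ext rfl (sequentialDistributionalTransform_pair_apply η ω n)
    · refine (measurable_distributionalTransform (condLaw η n)).comp (g := fun w => _)
        (f := fun w : ((Iio n → ℝ) × (Iio n → ℝ)) × (ℝ × ℝ) =>
          ((w.1.2, quantile (condLaw η n w.1.2) w.2.1), w.2.2)) ?_
      refine Measurable.prodMk (Measurable.prodMk (by fun_prop) ?_) (by fun_prop)
      exact (measurable_quantile_kernel (condLaw η n)).comp
        (f := fun w : ((Iio n → ℝ) × (Iio n → ℝ)) × (ℝ × ℝ) => (w.1.2, w.2.1)) (by fun_prop)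
    · intro a
      rw [Kernel.const_apply]
      refine Eq.trans ?_ (quantileCoupling_map_snd (condLaw η n) a.2)
      rw [← map_distributionalTransform, Measure.map_map measurable_snd ?_]
      · rfl
      · refine (measurable_quantile _).comp measurable_fst |>.prodMk ?_
        exact (measurable_distributionalTransform (condLaw η n)).comp (g := fun w => _)
          (f := fun e : ℝ × ℝ => ((a.2, quantile (condLaw η n a.2) e.1), e.2))
          (((measurable_const).prodMk ((measurable_quantile _).comp measurable_fst)).prodMk
            measurable_snd)
  · rw [pi_map_initial_prodMk uniform01 n (f := fun x (i : Iio n) => x i) (by fun_prop)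
      (fun x y h => funext fun i => h i i.2), Measure.compProd_const]

theorem quantileTransform_sequentialDistributionalTransform :
    ∀ᵐ z ∂η.prod (uniformCube N),
      quantileTransform η (sequentialDistributionalTransform η z) = z.1 := by
  have hY := triangular_quantileTransformPair_fst η
  have hm := measurable_quantileTransformPair η
  have hS := measurable_sequentialDistributionalTransform η
  -- One coordinate at a time, with the true path as past: the coupling lives on the graph of the
  -- quantile function. The final induction replaces this past by the regenerated one.
  have key : ∀ n, ∀ᵐ z ∂η.prod (uniformCube N), z.1 n = quantile
      (condLaw η n (fun i : Iio n => z.1 i)) (sequentialDistributionalTransform η z n) := by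
    intro n
    have hq := measurable_quantile_kernel (condLaw η n)
    have hset' : MeasurableSet {z : (Fin N → ℝ) × (Fin N → ℝ) | z.1 n = quantile
        (condLaw η n (fun i : Iio n => z.1 i)) (sequentialDistributionalTransform η z n)} :=
      measurableSet_eq_fun (by fun_prop) (hq.comp (f := fun z : (Fin N → ℝ) × (Fin N → ℝ) =>
        (fun i : Iio n => z.1 i, sequentialDistributionalTransform η z n)) (by fun_prop))
    rw [← map_quantileTransformPair η]
    refine (ae_map_iff hm.aemeasurable hset').2 ?_
    have hg : Measurable (fun w : (Iio n → ℝ) × (ℝ × ℝ) => (w.1,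
        quantile (condLaw η n w.1) w.2.1, distributionalTransform (condLaw η n)
          (w.1, quantile (condLaw η n w.1) w.2.1) w.2.2)) := by
      have h1 := hq.comp (f := fun w : (Iio n → ℝ) × (ℝ × ℝ) => (w.1, w.2.1)) (by fun_prop)
      refine measurable_fst.prodMk (h1.prodMk ?_)
      exact (measurable_distributionalTransform (condLaw η n)).comp (g := fun w => _)
        (f := fun w : (Iio n → ℝ) × (ℝ × ℝ) =>
          ((w.1, quantile (condLaw η n w.1) w.2.1), w.2.2))
        ((measurable_fst.prodMk h1).prodMk (by fun_prop))
    have hset : MeasurableSet {w : (Iio n → ℝ) × ℝ × ℝ | w.2.1 = quantile (condLaw η n w.1) w.2.2} :=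
      measurableSet_eq_fun (by fun_prop) (hq.comp
        (f := fun w : (Iio n → ℝ) × ℝ × ℝ => (w.1, w.2.2)) (by fun_prop))
    have h2 : ∀ᵐ w ∂((Measure.pi fun _ : Fin N => uniform01.prod uniform01).map
        (fun ω => fun i : Iio n => (quantileTransformPair η ω).1 i)).prod
        (uniform01.prod uniform01), quantile (condLaw η n w.1) w.2.1 = quantile (condLaw η n w.1)
          (distributionalTransform (condLaw η n)
          (w.1, quantile (condLaw η n w.1) w.2.1) w.2.2) := by
      refine (Measure.ae_prod_iff_ae_ae (hg hset)).2 (Filter.Eventually.of_forall fun a => ?_)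
      have h3 := ae_quantileCoupling (condLaw η n) a
      rw [← map_distributionalTransform] at h3
      exact ae_of_ae_map (measurable_snd.comp (hg.comp measurable_prodMk_left)).aemeasurable h3
    rw [← pi_map_initial_prodMk _ n (hY.measurable_initial n)
      (fun x y h => hY.initial_congr h)] at h2
    have h4 := ae_of_ae_map ((hY.measurable_initial n).prodMk
      (measurable_pi_apply n)).aemeasurable h2
    filter_upwards [h4] with ω hω
    rw [sequentialDistributionalTransform_pair_apply]
    refine Eq.trans ?_ hω
    change quantileTransform η (fun n => (ω n).1) n = _
    rw [quantileTransform]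
    rfl
  filter_upwards [ae_all_iff.2 key] with z hz
  funext n
  induction n using WellFoundedLT.induction with
  | ind n ih =>
    rw [hz n, quantileTransform]
    congr 2
    funext i
    exact ih i i.2

end

/-! ### Inversion of strictly increasing triangular maps -/

/-- Successive application of the distribution functions of the kernels `θ n`, evaluated at the
values obtained so far. -/
noncomputable def sequentialCdf {N : ℕ} (θ : ∀ n : Fin N, Kernel (Iio n → ℝ) ℝ) (z : Fin N → ℝ)
    (n : Fin N) : ℝ :=
  cdf (θ n (fun i : Iio n => sequentialCdf θ z i)) (z n)
termination_by n.val
decreasing_by exact i.2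

theorem triangular_sequentialCdf {N : ℕ} (θ : ∀ n : Fin N, Kernel (Iio n → ℝ) ℝ)
    [∀ n, IsMarkovKernel (θ n)] : Triangular (sequentialCdf θ) where
  measurable := measurable_pi_lambda _ fun n => by
    induction n using WellFoundedLT.induction with
    | ind n ih =>
      have hrec : (fun z => sequentialCdf θ z n) = fun z =>
          cdf (θ n (fun i : Iio n => sequentialCdf θ z i)) (z n) := by
        funext z; rw [sequentialCdf]
      rw [hrec]
      exact (measurable_cdf_kernel (θ n)).comp
        ((measurable_pi_lambda _ fun i : Iio n => ih i i.2).prodMk (measurable_pi_apply n))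
  congr n x y h := by
    induction n using WellFoundedLT.induction with
    | ind n ih =>
      rw [sequentialCdf, sequentialCdf, h n le_rfl]
      congr 3
      funext i
      exact ih i i.2 fun j hj => h j (hj.trans i.2.le)

theorem ae_uniformCube_mem_Ioo (N : ℕ) : ∀ᵐ x ∂uniformCube N, ∀ n, x n ∈ Ioo (0 : ℝ) 1 :=
  ae_all_iff.2 fun n =>
    (measurePreserving_eval (fun _ : Fin N => uniform01) n).quasiMeasurePreserving.ae
      ae_uniform01_mem_Ioo

/-- Once `x_i`, `i < n`, are recovered, the law `θ n` of the `n`-th component with a uniform `n`-th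
seed is known. By strict monotonicity its distribution function at `W x n` equals `x n`. -/
theorem Triangular.exists_leftInverse {N : ℕ} {W : (Fin N → ℝ) → Fin N → ℝ} (hW : Triangular W)
    (hmono : ∀ᵐ x ∂uniformCube N, ∀ n,
      StrictMonoOn (fun u => W (Function.update x n u) n) (Ioo 0 1)) :
    ∃ Φ : (Fin N → ℝ) → Fin N → ℝ, Triangular Φ ∧ ∀ᵐ x ∂uniformCube N, Φ (W x) = x := by
  -- Filling every index from `n` on with `z.2` is harmless: by triangularity only the entry at `n`
  -- matters.
  let g : ∀ n : Fin N, (Iio n → ℝ) × ℝ → ℝ := fun n z =>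
    W (fun i => if h : i < n then z.1 ⟨i, h⟩ else z.2) n
  have hg : ∀ n, Measurable (g n) := fun n =>
    (measurable_pi_apply n).comp (hW.measurable.comp (measurable_pi_lambda _ fun i => by
      by_cases h : i < n
      · simp only [h, dite_true]; fun_prop
      · simp only [h, dite_false]; fun_prop))
  let θ : ∀ n : Fin N, Kernel (Iio n → ℝ) ℝ := fun n =>
    (Kernel.id ×ₖ Kernel.const _ uniform01).map (g n)
  have hθ : ∀ n a, θ n a = uniform01.map (fun u => g n (a, u)) := fun n a => by
    rw [Kernel.map_apply _ (hg n), Kernel.prod_apply, Kernel.id_apply,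
      Kernel.const_apply, Measure.dirac_prod, Measure.map_map (hg n) measurable_prodMk_left]
    rfl
  have : ∀ n, IsMarkovKernel (θ n) := fun n => Kernel.IsMarkovKernel.map _ (hg n)
  refine ⟨sequentialCdf θ, triangular_sequentialCdf θ, ?_⟩
  filter_upwards [hmono, ae_uniformCube_mem_Ioo N] with x hx hx'
  funext n
  induction n using WellFoundedLT.induction with
  | ind n ih =>
    have h1 : (fun i : Iio n => sequentialCdf θ (W x) i) = fun i : Iio n => x i :=
      funext fun i => ih i i.2
    have h2 : ∀ u, g n (fun i : Iio n => x i, u) = W (Function.update x n u) n := fun u => by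
      refine hW.congr n _ _ fun i hi => ?_
      rcases hi.lt_or_eq with h | rfl
      · simp [h, h.ne]
      · simp
    have h3 : W x n = W (Function.update x n (x n)) n := by rw [Function.update_eq_self]
    rw [sequentialCdf, h1, hθ, h3]
    simp_rw [h2]
    refine cdf_map_uniform01_of_strictMonoOn ?_ (hx n) (hx' n)
    simp_rw [← h2]
    exact (hg n).comp measurable_prodMk_left

/-! ### Values of nonnegative programs -/

/-- The value of the stochastic program with a nonnegative cost `h`. -/
noncomputable def adaptedValue {N : ℕ} (h : (Fin N → ℝ) → (Fin N → ℝ) → ENNReal)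
    (η : Measure (Fin N → ℝ)) : ENNReal :=
  ⨅ u : AdaptedControl N, ∫⁻ y, h y (u.eval y) ∂η

section

variable {N : ℕ} {h : (Fin N → ℝ) → (Fin N → ℝ) → ENNReal}

theorem measurable_cost (hh : Measurable (Function.uncurry h)) {α : Type*} [MeasurableSpace α] {f g : α → Fin N → ℝ} (hf : Measurable f)
    (hg : Measurable g) : Measurable (fun x => h (f x) (g x)) :=
  hh.comp (hf.prodMk hg)

theorem adaptedValue_le_lintegral (η : Measure (Fin N → ℝ)) {w : (Fin N → ℝ) → Fin N → ℝ}
    (hw : Triangular w) : adaptedValue h η ≤ ∫⁻ y, h y (w y) ∂η := by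
  obtain ⟨u, rfl⟩ := hw.exists_adaptedControl
  exact iInf_le _ u

theorem adaptedValue_map_le_of_leftInverse (hh : Measurable (Function.uncurry h))
    {W Φ w : (Fin N → ℝ) → Fin N → ℝ} (hW : Triangular W)
    (hΦ : Triangular Φ) (hΦW : ∀ᵐ x ∂uniformCube N, Φ (W x) = x) (hw : Triangular w) :
    adaptedValue h ((uniformCube N).map W) ≤ ∫⁻ x, h (W x) (w x) ∂uniformCube N := by
  refine (adaptedValue_le_lintegral _ (hw.comp hΦ)).trans_eq ?_
  rw [lintegral_map (measurable_cost hh measurable_id' (hw.comp hΦ).measurable) hW.measurable]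
  refine lintegral_congr_ae ?_
  filter_upwards [hΦW] with x hx
  rw [hx]

/-- Replacing the seeds by their reconstruction from the path and an independent `v` preserves the
cost. For each fixed `v` the integral over the path is the cost of an adapted control, hence at
least the value; then average over `v`. -/
theorem adaptedValue_le_of_quantileTransform (hh : Measurable (Function.uncurry h))
    (η : Measure (Fin N → ℝ)) [IsProbabilityMeasure η]
    {w : (Fin N → ℝ) → Fin N → ℝ} (hw : Triangular w) :
    adaptedValue h η ≤ ∫⁻ x, h (quantileTransform η x) (w x) ∂uniformCube N := by
  have hΨ := measurable_sequentialDistributionalTransform η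
  have hwΨ : Measurable (fun z => w (sequentialDistributionalTransform η z)) :=
    hw.measurable.comp hΨ
  have h1 : ∫⁻ x, h (quantileTransform η x) (w x) ∂uniformCube N =
      ∫⁻ z, h z.1 (w (sequentialDistributionalTransform η z)) ∂η.prod (uniformCube N) := by
    conv_lhs => rw [← map_sequentialDistributionalTransform η]
    rw [lintegral_map (measurable_cost hh (measurable_quantileTransform η) hw.measurable) hΨ]
    refine lintegral_congr_ae ?_
    filter_upwards [quantileTransform_sequentialDistributionalTransform η] with z hz
    rw [hz]
  rw [h1, lintegral_prod_symm _ (measurable_cost hh measurable_fst hwΨ).aemeasurable]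
  calc adaptedValue h η = ∫⁻ _, adaptedValue h η ∂uniformCube N := by simp
    _ ≤ _ := lintegral_mono fun v => adaptedValue_le_lintegral η
        (hw.comp (triangular_sequentialDistributionalTransform η v))

end

/-! ### The lexicographic displacement interpolation -/

section

variable {N : ℕ} (μ ν : Measure (Fin N → ℝ)) [IsProbabilityMeasure μ] [IsProbabilityMeasure ν]

theorem triangular_interpolation (t : ℝ) : Triangular (fun x =>
    (1 - t) • quantileTransform μ x + t • quantileTransform ν x) where
  measurable := ((measurable_quantileTransform μ).const_smul (1 - t)).add
    ((measurable_quantileTransform ν).const_smul t)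
  congr n x y h := by
    simp only [Pi.add_apply, Pi.smul_apply, (triangular_quantileTransform μ).congr n x y h,
      (triangular_quantileTransform ν).congr n x y h]

theorem lexInterpolation_eq_map (t : ℝ) : lexInterpolation μ ν t = (uniformCube N).map (fun x =>
    (1 - t) • quantileTransform μ x + t • quantileTransform ν x) := by
  rw [lexInterpolation, knotheRosenblatt, Measure.map_map (by fun_prop)
    ((measurable_quantileTransform μ).prodMk (measurable_quantileTransform ν))]
  rfl

theorem AtomlessCondLaws.quantileTransform {μ : Measure (Fin N → ℝ)} [IsProbabilityMeasure μ]
    (hμ : AtomlessCondLaws μ) : ∀ᵐ x ∂uniformCube N, ∀ n : Fin N,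
      NullSingletonClass (condLaw μ n (fun i : Iio n => quantileTransform μ x i)) := by
  refine ae_of_ae_map (measurable_quantileTransform μ).aemeasurable
    (p := fun y => ∀ n : Fin N, NullSingletonClass (condLaw μ n (fun i => y i))) ?_
  rw [map_quantileTransform]
  exact hμ

theorem quantileTransform_update (x : Fin N → ℝ) (n : Fin N) (u : ℝ) :
    quantileTransform μ (Function.update x n u) n =
      quantile (condLaw μ n (fun i : Iio n => quantileTransform μ x i)) u := by
  rw [quantileTransform, Function.update_self,
    (triangular_quantileTransform μ).initial_congr (n := n) (y := x) fun i hi => by simp [hi.ne]]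

variable {μ}

theorem adaptedValue_lexInterpolation_le {h : (Fin N → ℝ) → (Fin N → ℝ) → ENNReal}
    (hh : Measurable (Function.uncurry h)) (hμ : AtomlessCondLaws μ) {t : ℝ}
    (ht : t ∈ Icc (0 : ℝ) 1) {w : (Fin N → ℝ) → Fin N → ℝ} (hw : Triangular w) :
    adaptedValue h (lexInterpolation μ ν t) ≤
      ∫⁻ x, h ((1 - t) • quantileTransform μ x + t • quantileTransform ν x) (w x)
        ∂uniformCube N := by
  -- At `t = 1` the strictly increasing contribution of `μ` vanishes, so the randomized
  -- reconstruction replaces inversion.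
  rcases ht.2.eq_or_lt with rfl | ht1
  · rw [lexInterpolation_eq_map]
    simp only [sub_self, zero_smul, zero_add, one_smul]
    exact (congrArg (adaptedValue h) (map_quantileTransform ν)).trans_le
      (adaptedValue_le_of_quantileTransform hh ν hw)
  · rw [lexInterpolation_eq_map]
    have hW := triangular_interpolation μ ν t
    obtain ⟨Φ, hΦ, hΦW⟩ := hW.exists_leftInverse (by
      filter_upwards [hμ.quantileTransform] with x hx n p hp q hq hpq
      have := hx n
      simp only [Pi.add_apply, Pi.smul_apply, quantileTransform_update, smul_eq_mul]
      exact add_lt_add_of_lt_of_le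
        (mul_lt_mul_of_pos_left (strictMonoOn_quantile _ hp hq hpq) (by linarith))
        (mul_le_mul_of_nonneg_left (monotoneOn_quantile _ hp hq hpq.le) ht.1))
    exact adaptedValue_map_le_of_leftInverse hh hW hΦ hΦW hw

/-! ### The Knothe–Rosenblatt map -/

variable (μ)

theorem measurable_knotheRosenblattMap : Measurable (knotheRosenblattMap μ ν) :=
  measurable_pi_lambda _ fun n => by
    induction n using WellFoundedLT.induction with
    | ind n ih =>
      have hrec : (fun x => knotheRosenblattMap μ ν x n) = fun x =>
          quantile (condLaw ν n (fun i : Iio n => knotheRosenblattMap μ ν x i))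
            (cdf (condLaw μ n (fun i => x i)) (x n)) := by
        funext x; rw [knotheRosenblattMap]
      rw [hrec]
      exact (measurable_quantile_kernel (condLaw ν n)).comp
        ((measurable_pi_lambda _ fun i : Iio n => ih i i.2).prodMk
          ((measurable_cdf_kernel (condLaw μ n)).comp
            (f := fun x : Fin N → ℝ => (fun i : Iio n => x i, x n)) (by fun_prop)))

variable {μ}

/-- For atomless laws the distribution function undoes the quantile function, so the map recovers
each seed and passes it to the quantile function of `ν`. -/
theorem knotheRosenblattMap_quantileTransform (hμ : AtomlessCondLaws μ) :
    ∀ᵐ x ∂uniformCube N,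
      knotheRosenblattMap μ ν (quantileTransform μ x) = quantileTransform ν x := by
  filter_upwards [hμ.quantileTransform, ae_uniformCube_mem_Ioo N] with x hx hx'
  funext n
  induction n using WellFoundedLT.induction with
  | ind n ih =>
    have := hx n
    have h1 : cdf (condLaw μ n (fun i : Iio n => quantileTransform μ x i))
        (quantileTransform μ x n) = x n := by
      conv_lhs => rw [quantileTransform]
      exact cdf_quantile _ (hx' n)
    rw [knotheRosenblattMap, h1, quantileTransform]
    congr 2
    funext i
    exact ih i i.2

end

/-! ### Extended integrals -/

theorem extIntegral_mono_ae {Ω : Type*} [MeasurableSpace Ω] {μ : Measure Ω} {f g : Ω → EReal}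
    (h : ∀ᵐ x ∂μ, f x ≤ g x) : extIntegral μ f ≤ extIntegral μ g := by
  refine EReal.sub_le_sub (EReal.coe_ennreal_le_coe_ennreal_iff.2 (lintegral_mono_ae ?_))
    (EReal.coe_ennreal_le_coe_ennreal_iff.2 (lintegral_mono_ae ?_))
  · filter_upwards [h] with x hx using EReal.toENNReal_le_toENNReal hx
  · filter_upwards [h] with x hx using EReal.toENNReal_le_toENNReal (EReal.neg_le_neg_iff.2 hx)

theorem EReal.coe_ennreal_sub_eq_of_add_eq {p m A B : ENNReal} (h : p + B = A + m) (hB : B ≠ ⊤)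
    (hm : m ≠ ⊤) : (p : EReal) - m = A - B := by
  lift B to NNReal using hB
  lift m to NNReal using hm
  rcases eq_or_ne p ⊤ with rfl | hp
  · have hA : A = ⊤ := by simpa using h.symm
    subst hA
    simp [EReal.coe_ennreal_top]
  · lift p to NNReal using hp
    have hA : A ≠ ⊤ := by rintro rfl; simp [← ENNReal.coe_add] at h
    lift A to NNReal using hA
    have h' : (p : ℝ) + B = A + m := by exact_mod_cast h
    simp only [EReal.coe_nnreal_eq_coe_real, ← EReal.coe_sub, EReal.coe_eq_coe_iff]
    linarith

/-- Integrate `f⁺ + b = a + f⁻`. Since `f⁻ ≤ b`, both subtracted integrals are finite, so `∞ - ∞`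
never occurs, even if `a` has infinite integral. -/
theorem extIntegral_coe_eq_sub {Ω : Type*} [MeasurableSpace Ω] {μ : Measure Ω} {f a b : Ω → ℝ}
    (hf : Measurable f) (hb : Measurable b) (hfab : ∀ᵐ x ∂μ, f x = a x - b x)
    (ha0 : ∀ᵐ x ∂μ, 0 ≤ a x) (hb0 : ∀ᵐ x ∂μ, 0 ≤ b x)
    (hfin : ∫⁻ x, ENNReal.ofReal (b x) ∂μ ≠ ⊤) :
    extIntegral μ (fun x => (f x : EReal)) =
      ((∫⁻ x, ENNReal.ofReal (a x) ∂μ : ENNReal) : EReal) -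
        ((∫⁻ x, ENNReal.ofReal (b x) ∂μ : ENNReal) : EReal) := by
  have h1 : extIntegral μ (fun x => (f x : EReal)) =
      ((∫⁻ x, ENNReal.ofReal (f x) ∂μ : ENNReal) : EReal) -
        ((∫⁻ x, ENNReal.ofReal (-f x) ∂μ : ENNReal) : EReal) := by
    simp only [extIntegral, ← EReal.coe_neg, EReal.toENNReal_of_ne_top (EReal.coe_ne_top _),
      EReal.toReal_coe]
  rw [h1]
  refine EReal.coe_ennreal_sub_eq_of_add_eq ?_ hfin ?_
  · have hf' : Measurable (fun x => -f x) := hf.neg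
    rw [← lintegral_add_right _ hb.ennreal_ofReal, ← lintegral_add_right _ hf'.ennreal_ofReal]
    refine lintegral_congr_ae ?_
    filter_upwards [hfab, ha0, hb0] with x hx ha hb
    rcases le_total 0 (f x) with h | h
    · rw [ENNReal.ofReal_of_nonpos (neg_nonpos.2 h), add_zero, ← ENNReal.ofReal_add h hb, hx,
        sub_add_cancel]
    · rw [ENNReal.ofReal_of_nonpos h, zero_add, ← ENNReal.ofReal_add ha (neg_nonneg.2 h), hx]
      congr 1
      ring
  · refine ne_top_of_le_ne_top hfin (lintegral_mono_ae ?_)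
    filter_upwards [hfab, ha0] with x hx ha
    exact ENNReal.ofReal_le_ofReal (by linarith)

/-! ### Costs bounded from below -/

/-- The nonnegative part of the cost above the level `c`. -/
noncomputable def shiftedCost {N : ℕ} (H : (Fin N → ℝ) → (Fin N → ℝ) → ℝ) (c : ℝ)
    (x u : Fin N → ℝ) : ENNReal :=
  ENNReal.ofReal (H x u - c)

section

variable {N : ℕ} {K : Set (Fin N → ℝ)} {H : (Fin N → ℝ) → (Fin N → ℝ) → ℝ}

theorem measurable_shiftedCost (hH : Measurable (Function.uncurry H)) (c : ℝ) :
    Measurable (Function.uncurry (shiftedCost H c)) :=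
  (hH.sub_const c).ennreal_ofReal

theorem expectedCost_eq_add (hH : Measurable (Function.uncurry H)) {c : ℝ} (hc0 : c ≤ 0)
    (hc : ∀ x ∈ K, ∀ u, c ≤ H x u) (η : Measure (Fin N → ℝ)) [IsProbabilityMeasure η]
    (hη : ∀ᵐ x ∂η, x ∈ K) (u : AdaptedControl N) :
    expectedCost H η u = ((∫⁻ x, shiftedCost H c x (u.eval x) ∂η : ENNReal) : EReal) + c := by
  have hm : Measurable (fun x => H x (u.eval x)) :=
    hH.comp (measurable_id.prodMk u.triangular.measurable)
  rw [expectedCost, extIntegral_coe_eq_sub (a := fun x => H x (u.eval x) - c) (b := fun _ => -c) hm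
    measurable_const (by simp)
    (by filter_upwards [hη] with x hx using sub_nonneg.2 (hc x hx _)) (by simpa using hc0)
    (by simp)]
  rw [lintegral_const, measure_univ, mul_one, EReal.coe_ennreal_ofReal,
    max_eq_left (neg_nonneg.2 hc0), EReal.coe_neg, sub_eq_add_neg, neg_neg]
  rfl

theorem programValue_eq_add (hH : Measurable (Function.uncurry H)) {c : ℝ} (hc0 : c ≤ 0)
    (hc : ∀ x ∈ K, ∀ u, c ≤ H x u) (η : Measure (Fin N → ℝ)) [IsProbabilityMeasure η]
    (hη : ∀ᵐ x ∂η, x ∈ K) :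
    programValue H η = (adaptedValue (shiftedCost H c) η : EReal) + c := by
  have hcost := expectedCost_eq_add hH hc0 hc η hη
  refine le_antisymm ?_ (le_iInf fun u => ?_)
  · rw [← EReal.sub_le_iff_le_add (Or.inl (EReal.coe_ne_bot c)) (Or.inl (EReal.coe_ne_top c))]
    -- Passing to `toENNReal` of the shifted value moves the comparison of infima into `ENNReal`.
    refine ((le_max_right 0 _).trans_eq EReal.coe_toENNReal_eq_max.symm).trans (EReal.coe_ennreal_le_coe_ennreal_iff.2
      (le_iInf fun u => ?_))
    rw [← EReal.toENNReal_coe (x := ∫⁻ y, _ ∂η)]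
    refine EReal.toENNReal_le_toENNReal ?_
    rw [EReal.sub_le_iff_le_add (Or.inl (EReal.coe_ne_bot c)) (Or.inl (EReal.coe_ne_top c)),
      ← hcost]
    exact iInf_le _ u
  · rw [hcost]
    exact add_le_add_left (EReal.coe_ennreal_le_coe_ennreal_iff.2 (iInf_le _ u)) _

variable {μ ν : Measure (Fin N → ℝ)} [IsProbabilityMeasure μ] [IsProbabilityMeasure ν]

theorem ae_quantileTransform_mem (hμ : μ Kᶜ = 0) :
    ∀ᵐ x ∂uniformCube N, quantileTransform μ x ∈ K := by
  refine ae_of_ae_map (measurable_quantileTransform μ).aemeasurable (p := fun y => y ∈ K) ?_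
  rw [map_quantileTransform]
  exact hμ

theorem ae_interpolation_mem (hKconv : Convex ℝ K) (hμ : μ Kᶜ = 0) (hν : ν Kᶜ = 0) {t : ℝ}
    (ht : t ∈ Icc (0 : ℝ) 1) : ∀ᵐ x ∂uniformCube N,
      (1 - t) • quantileTransform μ x + t • quantileTransform ν x ∈ K := by
  filter_upwards [ae_quantileTransform_mem hμ, ae_quantileTransform_mem hν] with x hx hy
  exact hKconv hx hy (by linarith [ht.2]) ht.1 (by ring)

theorem ae_lexInterpolation_mem (hK : MeasurableSet K) (hKconv : Convex ℝ K) (hμ : μ Kᶜ = 0)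
    (hν : ν Kᶜ = 0) {t : ℝ} (ht : t ∈ Icc (0 : ℝ) 1) : ∀ᵐ x ∂lexInterpolation μ ν t, x ∈ K := by
  rw [lexInterpolation_eq_map]
  exact (ae_map_iff (triangular_interpolation μ ν t).measurable.aemeasurable hK).2
    (ae_interpolation_mem hKconv hμ hν ht)

theorem adaptedValue_lexInterpolation_concave (hKconv : Convex ℝ K)
    (hH : Measurable (Function.uncurry H)) {c : ℝ} (hc : ∀ x ∈ K, ∀ u, c ≤ H x u)
    (hconcave : ∀ u, ConcaveOn ℝ K (fun x => H x u)) (hμK : μ Kᶜ = 0) (hνK : ν Kᶜ = 0)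
    (hμ : AtomlessCondLaws μ) {s t : ℝ} (hs : s ∈ Icc (0 : ℝ) 1) (ht : t ∈ Icc (0 : ℝ) 1) {a b : ℝ}
    (ha : 0 ≤ a) (hb : 0 ≤ b) (hab : a + b = 1) :
    ENNReal.ofReal a * adaptedValue (shiftedCost H c) (lexInterpolation μ ν s) +
        ENNReal.ofReal b * adaptedValue (shiftedCost H c) (lexInterpolation μ ν t) ≤
      adaptedValue (shiftedCost H c) (lexInterpolation μ ν (a * s + b * t)) := by
  have hh := measurable_shiftedCost hH c
  refine le_iInf fun u => ?_
  have hW := triangular_interpolation μ ν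
  have hw := u.triangular.comp (hW (a * s + b * t))
  rw [lexInterpolation_eq_map μ ν (a * s + b * t), lintegral_map
    (measurable_cost hh measurable_id' u.triangular.measurable) (hW _).measurable]
  refine (add_le_add (mul_le_mul_right (adaptedValue_lexInterpolation_le ν hh hμ hs hw) _)
    (mul_le_mul_right (adaptedValue_lexInterpolation_le ν hh hμ ht hw) _)).trans ?_
  rw [← lintegral_const_mul _ (measurable_cost hh (hW s).measurable hw.measurable),
    ← lintegral_const_mul _ (measurable_cost hh (hW t).measurable hw.measurable),
    ← lintegral_add_left ((measurable_cost hh (hW s).measurable hw.measurable).const_mul _)]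
  refine lintegral_mono_ae ?_
  filter_upwards [ae_interpolation_mem hKconv hμK hνK hs, ae_interpolation_mem hKconv hμK hνK ht]
    with x hxs hxt
  have hcomb : (1 - (a * s + b * t)) • quantileTransform μ x +
      (a * s + b * t) • quantileTransform ν x =
      a • ((1 - s) • quantileTransform μ x + s • quantileTransform ν x) +
        b • ((1 - t) • quantileTransform μ x + t • quantileTransform ν x) := by
    obtain rfl : b = 1 - a := by linarith
    module
  set w := u.eval ((1 - (a * s + b * t)) • quantileTransform μ x +
      (a * s + b * t) • quantileTransform ν x)
  have h := (hconcave w).2 hxs hxt ha hb hab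
  rw [← hcomb] at h
  simp only [smul_eq_mul] at h
  rw [shiftedCost, shiftedCost, shiftedCost, ← ENNReal.ofReal_mul ha, ← ENNReal.ofReal_mul hb,
    ← ENNReal.ofReal_add (mul_nonneg ha (sub_nonneg.2 (hc _ hxs _)))
      (mul_nonneg hb (sub_nonneg.2 (hc _ hxt _)))]
  refine ENNReal.ofReal_le_ofReal ?_
  have : a * c + b * c = c := by rw [← add_mul, hab, one_mul]
  linarith

theorem programValue_lexInterpolation_concave (hK : MeasurableSet K) (hKconv : Convex ℝ K)
    (hH : Measurable (Function.uncurry H)) {c : ℝ} (hc0 : c ≤ 0) (hc : ∀ x ∈ K, ∀ u, c ≤ H x u)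
    (hconcave : ∀ u, ConcaveOn ℝ K (fun x => H x u)) (hμK : μ Kᶜ = 0) (hνK : ν Kᶜ = 0)
    (hμ : AtomlessCondLaws μ) {s t : ℝ} (hs : s ∈ Icc (0 : ℝ) 1) (ht : t ∈ Icc (0 : ℝ) 1) {a b : ℝ}
    (ha : 0 ≤ a) (hb : 0 ≤ b) (hab : a + b = 1) :
    (a : EReal) * programValue H (lexInterpolation μ ν s) +
        (b : EReal) * programValue H (lexInterpolation μ ν t) ≤
      programValue H (lexInterpolation μ ν (a * s + b * t)) := by
  have hr : a * s + b * t ∈ Icc (0 : ℝ) 1 := convex_Icc (0 : ℝ) 1 hs ht ha hb hab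
  have hval : ∀ r ∈ Icc (0 : ℝ) 1, programValue H (lexInterpolation μ ν r) =
      (adaptedValue (shiftedCost H c) (lexInterpolation μ ν r) : EReal) + c := fun r hr =>
    programValue_eq_add hH hc0 hc _ (ae_lexInterpolation_mem hK hKconv hμK hνK hr)
  have key := EReal.coe_ennreal_le_coe_ennreal_iff.2
    (adaptedValue_lexInterpolation_concave hKconv hH hc hconcave hμK hνK hμ hs ht ha hb hab)
  rw [EReal.coe_ennreal_add, EReal.coe_ennreal_mul, EReal.coe_ennreal_mul, EReal.coe_ennreal_ofReal,
    EReal.coe_ennreal_ofReal, max_eq_left ha, max_eq_left hb] at key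
  rw [hval s hs, hval t ht, hval _ hr,
    EReal.left_distrib_of_nonneg_of_ne_top (EReal.coe_nonneg.2 ha) (EReal.coe_ne_top a),
    EReal.left_distrib_of_nonneg_of_ne_top (EReal.coe_nonneg.2 hb) (EReal.coe_ne_top b),
    add_add_add_comm, ← EReal.coe_mul, ← EReal.coe_mul, ← EReal.coe_add, ← add_mul, hab, one_mul]
  exact add_le_add_left key _

theorem programValue_le_add_extIntegral (hK : MeasurableSet K)
    (hH : Measurable (Function.uncurry H)) {c : ℝ} (hc0 : c ≤ 0) (hc : ∀ x ∈ K, ∀ u, c ≤ H x u)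
    (hμK : μ Kᶜ = 0) (hνK : ν Kᶜ = 0) (hμ : AtomlessCondLaws μ) (hfin : programValue H μ < ⊤)
    {u : AdaptedControl N} (hu : u ∈ optimalControls H μ) :
    programValue H ν ≤ programValue H μ + extIntegral μ (fun x =>
      ⨅ ξ ∈ superdifferential K (fun z => H z (u.eval x)) x,
        ((ξ ⬝ᵥ (knotheRosenblattMap μ ν x - x) : ℝ) : EReal)) := by
  have hh := measurable_shiftedCost hH c
  have hT := measurable_knotheRosenblattMap μ ν
  have hum := u.triangular.measurable
  have hTS := knotheRosenblattMap_quantileTransform ν hμ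
  have hTK : ∀ᵐ x ∂μ, knotheRosenblattMap μ ν x ∈ K := by
    have h : ∀ᵐ x ∂(uniformCube N).map (quantileTransform μ), knotheRosenblattMap μ ν x ∈ K := by
      refine (ae_map_iff (measurable_quantileTransform μ).aemeasurable (hT hK)).2 ?_
      filter_upwards [hTS, ae_quantileTransform_mem hνK] with x hx hx'
      rwa [hx]
    rwa [map_quantileTransform] at h
  have hμK' : ∀ᵐ x ∂μ, x ∈ K := hμK
  -- `A` is the cost of noise `T(x)` under the decision `u(x)`, which need not be a function of
  -- `T(x)`. It may be infinite, whereas `B` is finite by finiteness of `v(μ)`.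
  set A := ∫⁻ x, shiftedCost H c (knotheRosenblattMap μ ν x) (u.eval x) ∂μ
  set B := ∫⁻ x, shiftedCost H c x (u.eval x) ∂μ
  have hvμ : programValue H μ = (B : EReal) + c :=
    hu.symm.trans (expectedCost_eq_add hH hc0 hc μ hμK' u)
  have hBfin : B ≠ ⊤ := by
    intro hBtop
    rw [hvμ, hBtop, EReal.coe_ennreal_top, EReal.top_add_coe] at hfin
    exact lt_irrefl _ hfin
  have hνA : adaptedValue (shiftedCost H c) ν ≤ A := by
    have h1 : A = ∫⁻ x, shiftedCost H c (quantileTransform ν x)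
        (u.eval (quantileTransform μ x)) ∂uniformCube N := by
      have h2 : A = ∫⁻ x, shiftedCost H c (knotheRosenblattMap μ ν x) (u.eval x)
        ∂(uniformCube N).map (quantileTransform μ) := by rw [map_quantileTransform]
      rw [h2, lintegral_map (measurable_cost hh hT hum) (measurable_quantileTransform μ)]
      refine lintegral_congr_ae ?_
      filter_upwards [hTS] with x hx
      rw [hx]
    rw [h1]
    exact adaptedValue_le_of_quantileTransform hh ν
      (u.triangular.comp (triangular_quantileTransform μ))
  have hHx : Measurable (fun x => H x (u.eval x)) := hH.comp (measurable_id.prodMk hum)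
  have hHT : Measurable (fun x => H (knotheRosenblattMap μ ν x) (u.eval x)) :=
    hH.comp (hT.prodMk hum)
  have hdiff : (A : EReal) - B ≤ extIntegral μ (fun x =>
      ⨅ ξ ∈ superdifferential K (fun z => H z (u.eval x)) x,
        ((ξ ⬝ᵥ (knotheRosenblattMap μ ν x - x) : ℝ) : EReal)) := by
    refine (extIntegral_coe_eq_sub (μ := μ)
      (f := fun x => H (knotheRosenblattMap μ ν x) (u.eval x) - H x (u.eval x))
      (a := fun x => H (knotheRosenblattMap μ ν x) (u.eval x) - c)
      (b := fun x => H x (u.eval x) - c) (hHT.sub hHx) (hHx.sub_const c)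
      (Filter.Eventually.of_forall fun x => by ring) ?_ ?_ hBfin).symm.trans_le
      (extIntegral_mono_ae ?_)
    · filter_upwards [hTK] with x hx using sub_nonneg.2 (hc _ hx _)
    · filter_upwards [hμK'] with x hx using sub_nonneg.2 (hc _ hx _)
    · filter_upwards [hTK] with x hx
      refine le_iInf₂ fun ξ hξ => EReal.coe_le_coe_iff.2 ?_
      have := hξ _ hx
      linarith
  have hBA : (A : EReal) = B + (A - B) := by
    rw [add_comm, ← ENNReal.coe_toNNReal hBfin, EReal.coe_nnreal_eq_coe_real, EReal.sub_add_cancel]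
  rw [programValue_eq_add hH hc0 hc ν hνK, hvμ, add_right_comm]
  refine add_le_add_left ((EReal.coe_ennreal_le_coe_ennreal_iff.2 hνA).trans ?_) _
  rw [hBA]
  exact add_le_add_right hdiff _

end

theorem mainTheorem8 {N : ℕ} (K : Set (Fin N → ℝ)) (hK : MeasurableSet K) (hKconv : Convex ℝ K)
    (H : (Fin N → ℝ) → (Fin N → ℝ) → ℝ)
    (hmeas : Measurable (Function.uncurry H))
    (hbdd : ∃ c : ℝ, ∀ x ∈ K, ∀ u, c ≤ H x u)
    (hconcave : ∀ u, ConcaveOn ℝ K (fun x => H x u))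
    (hconvex : ∀ x ∈ K, ConvexOn ℝ Set.univ (H x))
    (μ ν : Measure (Fin N → ℝ)) [IsProbabilityMeasure μ] [IsProbabilityMeasure ν]
    (hμK : μ Kᶜ = 0) (hνK : ν Kᶜ = 0)
    (hatom : AtomlessCondLaws μ) :
    (∀ s ∈ Icc (0 : ℝ) 1, ∀ t ∈ Icc (0 : ℝ) 1, ∀ a b : ℝ, 0 ≤ a → 0 ≤ b → a + b = 1 →
      (a : EReal) * programValue H (lexInterpolation μ ν s) +
          (b : EReal) * programValue H (lexInterpolation μ ν t) ≤
        programValue H (lexInterpolation μ ν (a * s + b * t))) ∧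
    (programValue H μ < ⊤ → (optimalControls H μ).Nonempty →
      programValue H ν ≤ programValue H μ +
        ⨅ u ∈ optimalControls H μ,
          extIntegral μ (fun x =>
            ⨅ ξ ∈ superdifferential K (fun z => H z (u.eval x)) x,
              ((ξ ⬝ᵥ (knotheRosenblattMap μ ν x - x) : ℝ) : EReal))) := by
  obtain ⟨c', hc'⟩ := hbdd
  -- With `c ≤ 0`, the splitting `H = (H - c) - (-c)` has nonnegative terms on `K`.
  obtain ⟨c, hc0, hc⟩ : ∃ c : ℝ, c ≤ 0 ∧ ∀ x ∈ K, ∀ u, c ≤ H x u :=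
    ⟨min c' 0, min_le_right _ _, fun x hx u => (min_le_left _ _).trans (hc' x hx u)⟩
  refine ⟨fun s hs t ht a b ha hb hab => programValue_lexInterpolation_concave hK hKconv hmeas hc0
    hc hconcave hμK hνK hatom hs ht ha hb hab, fun hfin _ => ?_⟩
  have hbot : programValue H μ ≠ ⊥ := by
    rw [programValue_eq_add hmeas hc0 hc μ hμK]
    simp [EReal.add_eq_bot_iff]
  -- Finiteness of `v(μ)` lets it change sides, so the infimum over optimal controls can be treated
  -- one control at a time.
  rw [add_comm, ← EReal.sub_le_iff_le_add (Or.inl hbot) (Or.inl hfin.ne)]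
  refine le_iInf₂ fun u hu => ?_
  rw [EReal.sub_le_iff_le_add (Or.inl hbot) (Or.inl hfin.ne), add_comm]
  exact programValue_le_add_extIntegral hK hmeas hc0 hc hμK hνK hatom hfin hu
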